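/- For a finite group $G$ and a positive integer $k$ let $\psi_k(G)=\sum_{g\in G} o(g)^k$, where $o(g)$ is the order of the element $g$, and let $\mathbb{Z}_n$ denote the cyclic group of order $n$. If $G$ is a non-cyclic group of finite order $n$ and $k$ is a positive integer, then $$\psi_k(G)\le \frac{1+3\cdot 2^k}{1+2^k+2\cdot 4^k}\,\psi_k(\mathbb{Z}_n).$$ In particular (taking $k=1$), $\psi_1(G)\le \frac{7}{11}\,\psi_1(\mathbb{Z}_n)$ for every non-cyclic group $G$ of finite order $n$. Moreover, the bound is attained: for every odd positive integer $t$ and every positive integer $k$, the group $\mathbb{Z}_t\times\mathbb{Z}_2\times\mathbb{Z}_2$ is a non-cyclic group of order $4t$, and $$\psi_k(\mathbb{Z}_t\times\mathbb{Z}_2\times\mathbb{Z}_2)=\frac{1+3\cdot 2^k}{1+2^k+2\cdot 4^k}\,\psi_k(\mathbb{Z}_{4t}).$$ -/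

import Mathlib

/-- `psi k G` is `ψ_k(G) = ∑_{g ∈ G} o(g)^k`, the sum of the `k`-th powers of the orders of the
elements of the finite group `G`. -/
noncomputable def psi (k : ℕ) (G : Type*) [Group G] [Fintype G] : ℕ :=
  ∑ g : G, orderOf g ^ k

/-- The cyclic group `ℤ_n` (integers modulo `n`), written multiplicatively. -/
abbrev Cyc (n : ℕ) : Type := Multiplicative (ZMod n)

/-! The constant is ψ_k(ℤ_2×ℤ_2)/ψ_k(ℤ_4); the bound is proved cross-multiplied in ℕ, by strong
induction on n, with p the largest prime divisor of n. If p = 2, no element has order n, and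
comparing with n/2 and n/4 suffices (`psi_le_of_card_eq_two_pow`). If p is odd and all cyclic
subgroups have index at least p, then ψ_k(G) ≤ n(n/p)^k. This is compared with ψ_k(ℤ_n) ≥ n^(k+1)/p
for k ≥ 2, and with the sharper ψ_1(ℤ_n) ≥ 2n²/(p+1) for k = 1 (`psi_le_of_forall_orderOf_mul_le`).
Otherwise a cyclic subgroup of index less than p contains a Sylow p-subgroup P, which is then cyclic
and normal (`exists_normal_zpowers`). Summing over cosets gives ψ_k(G) ≤ ψ_k(P)ψ_k(G/P), so
induction settles noncyclic G/P. If G/P is cyclic, the image of the centralizer of P in it is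
proper, and each coset c outside this image contributes only |P|·o(c)^k; that saving is enough
(`psi_le_of_isCyclic_quotient`). -/

/-! ### Arithmetic of ψ_k on cyclic groups. -/

/-- `∑_{d ∣ n} φ(d) d ^ k`, the value of `psi k` on cyclic groups of order `n`. -/
def cycPsi (k n : ℕ) : ℕ := ∑ d ∈ n.divisors, d.totient * d ^ k

@[simp] theorem cycPsi_one (k : ℕ) : cycPsi k 1 = 1 := by simp [cycPsi]

theorem cycPsi_mul_of_coprime (k : ℕ) {m n : ℕ} (h : m.Coprime n) :
    cycPsi k (m * n) = cycPsi k m * cycPsi k n := by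
  unfold cycPsi
  rw [Nat.divisors_mul, Finset.mul_def, Finset.sum_image h.mul_injOn_divisors, Finset.sum_product,
    Finset.sum_mul_sum]
  refine Finset.sum_congr rfl fun a ha => Finset.sum_congr rfl fun b hb => ?_
  have hab : a.Coprime b :=
    Nat.Coprime.of_dvd (Nat.dvd_of_mem_divisors ha) (Nat.dvd_of_mem_divisors hb) h
  simp only [Nat.totient_mul hab, mul_pow]
  ring

theorem totient_mul_pow_le_cycPsi (k : ℕ) {n : ℕ} (hn : n ≠ 0) :
    n.totient * n ^ k ≤ cycPsi k n :=
  Finset.single_le_sum (f := fun d => d.totient * d ^ k) (fun _ _ => Nat.zero_le _)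
    (Nat.mem_divisors_self n hn)

theorem cycPsi_le_pow (k n : ℕ) : cycPsi k n ≤ n ^ (k + 1) := by
  calc cycPsi k n ≤ ∑ d ∈ n.divisors, d.totient * n ^ k :=
        Finset.sum_le_sum fun d hd => Nat.mul_le_mul_left _
          (Nat.pow_le_pow_left (Nat.divisor_le hd) k)
    _ = n ^ (k + 1) := by rw [← Finset.sum_mul, Nat.sum_totient, pow_succ']

theorem cycPsi_le_of_dvd (k : ℕ) {m n : ℕ} (h : m ∣ n) (hn : n ≠ 0) :
    cycPsi k m ≤ cycPsi k n :=
  Finset.sum_le_sum_of_subset (Nat.divisors_subset_of_dvd hn h)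

/-- An even cyclic group has half of its elements in the subgroup of index two. -/
theorem cycPsi_two_mul_le (k : ℕ) {m : ℕ} (hm : m ≠ 0) :
    cycPsi k (2 * m) ≤ m ^ (k + 1) + m * (2 * m) ^ k := by
  have hsub : m.divisors ⊆ (2 * m).divisors :=
    Nat.divisors_subset_of_dvd (by positivity) (Dvd.intro_left 2 rfl)
  have htot : ∑ d ∈ (2 * m).divisors \ m.divisors, d.totient = m := by
    have h := Finset.sum_sdiff hsub (f := Nat.totient)
    rw [Nat.sum_totient, Nat.sum_totient] at h
    lia
  have hsd := Finset.sum_sdiff hsub (f := fun d => d.totient * d ^ k)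
  have hle : ∑ d ∈ (2 * m).divisors \ m.divisors, d.totient * d ^ k ≤ m * (2 * m) ^ k := by
    calc _ ≤ ∑ d ∈ (2 * m).divisors \ m.divisors, d.totient * (2 * m) ^ k :=
          Finset.sum_le_sum fun d hd => Nat.mul_le_mul_left _
            (Nat.pow_le_pow_left (Nat.divisor_le (Finset.mem_sdiff.1 hd).1) k)
      _ = _ := by rw [← Finset.sum_mul, htot]
  have hm' := cycPsi_le_pow k m
  unfold cycPsi at *
  lia

theorem cycPsi_prime_pow_succ (k b : ℕ) {q : ℕ} (hq : q.Prime) :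
    cycPsi k (q ^ (b + 1)) =
      cycPsi k (q ^ b) + (q ^ (b + 1)).totient * (q ^ (b + 1)) ^ k := by
  unfold cycPsi
  rw [Nat.sum_divisors_prime_pow hq, Nat.sum_divisors_prime_pow hq, Finset.sum_range_succ]

/-- The elements of the new order q^(b+1) alone contribute at least q^k·(q^b)^(k+1), which dominates
2^k times the old sum. -/
theorem one_add_two_pow_mul_cycPsi_prime_pow_le (k b : ℕ) {q : ℕ} (hq : q.Prime) :
    (1 + 2 ^ k) * cycPsi k (q ^ b) ≤ cycPsi k (q ^ (b + 1)) := by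
  rw [cycPsi_prime_pow_succ k b hq, add_mul, one_mul, Nat.totient_prime_pow_succ hq]
  have h1 : cycPsi k (q ^ b) ≤ q ^ b * (q ^ b) ^ k := by
    simpa [pow_succ'] using cycPsi_le_pow k (q ^ b)
  have h2 : 2 ^ k ≤ q ^ k := Nat.pow_le_pow_left hq.two_le k
  have h3 : 1 ≤ q - 1 := by have := hq.two_le; lia
  calc cycPsi k (q ^ b) + 2 ^ k * cycPsi k (q ^ b)
      ≤ cycPsi k (q ^ b) + q ^ k * (q ^ b * (q ^ b) ^ k) := by gcongr
    _ = cycPsi k (q ^ b) + q ^ b * 1 * (q ^ (b + 1)) ^ k := by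
        rw [pow_succ' q b, mul_pow]; ring
    _ ≤ _ := by gcongr

theorem one_add_two_pow_mul_cycPsi_le (k : ℕ) {m n : ℕ} (h : m ∣ n) (hmn : m ≠ n)
    (hn : n ≠ 0) : (1 + 2 ^ k) * cycPsi k m ≤ cycPsi k n := by
  obtain ⟨d, rfl⟩ := h
  have hm : m ≠ 0 := left_ne_zero_of_mul hn
  obtain ⟨q, hq, hqd⟩ := Nat.exists_prime_and_dvd (n := d) (by rintro rfl; simp at hmn)
  refine le_trans ?_ (cycPsi_le_of_dvd k (mul_dvd_mul_left m hqd) hn)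
  obtain ⟨b, r, hr, rfl⟩ := Nat.exists_eq_pow_mul_and_not_dvd hm q hq.ne_one
  have hcop : ∀ c, (q ^ c).Coprime r := fun c =>
    ((Nat.Prime.coprime_iff_not_dvd hq).2 hr).pow_left c
  have hrw : q ^ b * r * q = q ^ (b + 1) * r := by ring
  rw [hrw, cycPsi_mul_of_coprime k (hcop _), cycPsi_mul_of_coprime k (hcop _), ← mul_assoc]
  exact Nat.mul_le_mul_right _ (one_add_two_pow_mul_cycPsi_prime_pow_le k b hq)

/-! ### Lower bounds for φ(n) and ψ_1(ℤ_n) in terms of the largest prime divisor. -/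

/-- Enlarging S to all of {2, …, p} makes the product of (q+1)/q telescope to (p+1)/2. -/
theorem two_mul_prod_add_one_le {p : ℕ} (hp : 1 ≤ p) :
    ∀ S ⊆ Finset.Icc 2 p, 2 * ∏ q ∈ S, (q + 1) ≤ (p + 1) * ∏ q ∈ S, q := by
  induction p, hp using Nat.le_induction with
  | base => intro S hS; simp at hS; simp [hS]
  | succ p hp ih =>
    intro S hS
    have hS' : S.erase (p + 1) ⊆ Finset.Icc 2 p := by
      intro a ha
      have h1 := Finset.mem_Icc.1 (hS (Finset.mem_of_mem_erase ha))
      have h2 := Finset.ne_of_mem_erase ha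
      exact Finset.mem_Icc.2 ⟨h1.1, by lia⟩
    have h := ih _ hS'
    by_cases hmem : p + 1 ∈ S
    · rw [← Finset.mul_prod_erase S _ hmem, ← Finset.mul_prod_erase S _ hmem]
      nlinarith
    · rw [Finset.erase_eq_of_notMem hmem] at h
      exact h.trans (Nat.mul_le_mul_right _ (by lia))

/-- Same telescoping: the product of q/(q-1) over {2, …, p} is p. -/
theorem prod_le_mul_prod_sub_one {p : ℕ} (hp : 1 ≤ p) :
    ∀ S ⊆ Finset.Icc 2 p, ∏ q ∈ S, q ≤ p * ∏ q ∈ S, (q - 1) := by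
  induction p, hp using Nat.le_induction with
  | base => intro S hS; simp at hS; simp [hS]
  | succ p hp ih =>
    intro S hS
    have hS' : S.erase (p + 1) ⊆ Finset.Icc 2 p := by
      intro a ha
      have h1 := Finset.mem_Icc.1 (hS (Finset.mem_of_mem_erase ha))
      have h2 := Finset.ne_of_mem_erase ha
      exact Finset.mem_Icc.2 ⟨h1.1, by lia⟩
    have h := ih _ hS'
    by_cases hmem : p + 1 ∈ S
    · rw [← Finset.mul_prod_erase S _ hmem, ← Finset.mul_prod_erase S _ hmem,
        Nat.add_sub_cancel]
      nlinarith
    · rw [Finset.erase_eq_of_notMem hmem] at h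
      exact h.trans (Nat.mul_le_mul_right _ (by lia))

theorem primeFactors_subset_Icc {n p : ℕ} (hp : ∀ q ∈ n.primeFactors, q ≤ p) :
    n.primeFactors ⊆ Finset.Icc 2 p := fun q hq =>
  Finset.mem_Icc.2 ⟨(Nat.prime_of_mem_primeFactors hq).two_le, hp q hq⟩

theorem le_mul_totient {n p : ℕ} (hp1 : 1 ≤ p) (hp : ∀ q ∈ n.primeFactors, q ≤ p) :
    n ≤ p * n.totient := by
  have h1 := prod_le_mul_prod_sub_one hp1 _ (primeFactors_subset_Icc hp)
  have h2 := Nat.totient_mul_prod_primeFactors n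
  have hpos : 0 < ∏ q ∈ n.primeFactors, q :=
    Finset.prod_pos fun q hq => (Nat.prime_of_mem_primeFactors hq).pos
  refine Nat.le_of_mul_le_mul_right (c := ∏ q ∈ n.primeFactors, q) ?_ hpos
  calc n * ∏ q ∈ n.primeFactors, q ≤ n * (p * ∏ q ∈ n.primeFactors, (q - 1)) := by gcongr
    _ = p * (n * ∏ q ∈ n.primeFactors, (q - 1)) := by ring
    _ = _ := by rw [← h2]; ring

theorem cycPsi_one_prime_pow {q : ℕ} (hq : q.Prime) (a : ℕ) :
    (q + 1) * cycPsi 1 (q ^ a) = q * (q ^ a) ^ 2 + 1 := by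
  induction a with
  | zero => simp
  | succ a ih =>
    rw [cycPsi_prime_pow_succ 1 a hq, mul_add, ih, Nat.totient_prime_pow_succ hq]
    obtain ⟨r, rfl⟩ : ∃ r, q = r + 1 := ⟨q - 1, by have := hq.pos; lia⟩
    simp only [Nat.add_sub_cancel]
    ring

theorem two_mul_sq_le_cycPsi_one {n p : ℕ} (hn : n ≠ 0) (hp1 : 1 ≤ p)
    (hp : ∀ q ∈ n.primeFactors, q ≤ p) : 2 * n ^ 2 ≤ (p + 1) * cycPsi 1 n := by
  have h1 := two_mul_prod_add_one_le hp1 _ (primeFactors_subset_Icc hp)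
  have hpos : 0 < ∏ q ∈ n.primeFactors, q :=
    Finset.prod_pos fun q hq => (Nat.prime_of_mem_primeFactors hq).pos
  have hf : cycPsi 1 n = ∏ q ∈ n.primeFactors, cycPsi 1 (q ^ n.factorization q) :=
    Nat.multiplicative_factorization (cycPsi 1) (fun _ _ => cycPsi_mul_of_coprime 1)
      (cycPsi_one 1) hn
  have hn' : n = ∏ q ∈ n.primeFactors, q ^ n.factorization q :=
    (Nat.prod_factorization_pow_eq_self hn).symm
  have h2 : (∏ q ∈ n.primeFactors, q) * n ^ 2 ≤
      (∏ q ∈ n.primeFactors, (q + 1)) * cycPsi 1 n := by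
    have hsq : n ^ 2 = ∏ q ∈ n.primeFactors, (q ^ n.factorization q) ^ 2 := by
      rw [Finset.prod_pow, ← hn']
    rw [hf, hsq, ← Finset.prod_mul_distrib, ← Finset.prod_mul_distrib]
    refine Finset.prod_le_prod' fun q hq => ?_
    rw [cycPsi_one_prime_pow (Nat.prime_of_mem_primeFactors hq)]
    exact Nat.le_succ _
  refine le_of_mul_le_mul_left ?_ hpos
  calc (∏ q ∈ n.primeFactors, q) * (2 * n ^ 2)
      = 2 * ((∏ q ∈ n.primeFactors, q) * n ^ 2) := by ring
    _ ≤ 2 * ((∏ q ∈ n.primeFactors, (q + 1)) * cycPsi 1 n) := by gcongr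
    _ = (2 * ∏ q ∈ n.primeFactors, (q + 1)) * cycPsi 1 n := by ring
    _ ≤ ((p + 1) * ∏ q ∈ n.primeFactors, q) * cycPsi 1 n := by gcongr
    _ = _ := by ring

/-! ### General estimates for ψ_k of a finite group. -/

theorem psi_eq_cycPsi (k : ℕ) (G : Type*) [Group G] [Fintype G] [IsCyclic G] :
    psi k G = cycPsi k (Fintype.card G) := by
  classical
  unfold psi cycPsi
  rw [← Finset.sum_fiberwise_of_maps_to (s := Finset.univ) (t := (Fintype.card G).divisors)
    (g := fun g : G => orderOf g)
    (fun g _ => Nat.mem_divisors.2 ⟨orderOf_dvd_card, Fintype.card_ne_zero⟩)]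
  refine Finset.sum_congr rfl fun d hd => ?_
  rw [← IsCyclic.card_orderOf_eq_totient (α := G) (Nat.dvd_of_mem_divisors hd),
    Finset.sum_congr rfl (g := fun _ => d ^ k) (fun g hg => by rw [(Finset.mem_filter.1 hg).2]),
    Finset.sum_const, smul_eq_mul]

theorem psi_subgroup (k : ℕ) {G : Type*} [Group G] [Fintype G] (H : Subgroup G) [Fintype H] :
    psi k H = ∑ h : H, orderOf (h : G) ^ k := by
  simp [psi]

theorem psi_le_of_orderOf_le (k N : ℕ) (G : Type*) [Group G] [Fintype G]
    (h : ∀ g : G, orderOf g ≤ N) : psi k G ≤ Fintype.card G * N ^ k := by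
  calc psi k G ≤ ∑ _g : G, N ^ k := Finset.sum_le_sum fun g _ => Nat.pow_le_pow_left (h g) k
    _ = _ := by simp

/-- Separating the cyclic subgroup generated by an element of maximal order. -/
theorem psi_le_of_orderOf_le_orderOf (k : ℕ) {G : Type*} [Group G] [Fintype G] (x : G)
    (h : ∀ g : G, orderOf g ≤ orderOf x) :
    psi k G ≤ cycPsi k (orderOf x) + (Fintype.card G - orderOf x) * orderOf x ^ k := by
  classical
  have h1 := Finset.sum_filter_add_sum_filter_not Finset.univ
    (fun g => g ∈ Subgroup.zpowers x) (fun g : G => orderOf g ^ k)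
  have hcard : (Finset.univ.filter (fun g => g ∈ Subgroup.zpowers x)).card = orderOf x := by
    rw [← Fintype.card_zpowers, Fintype.card_subtype]
  have h2 : ∑ g with g ∈ Subgroup.zpowers x, orderOf g ^ k = cycPsi k (orderOf x) := by
    rw [← Fintype.card_zpowers, ← psi_eq_cycPsi, psi_subgroup]
    exact Finset.sum_subtype _ (by simp) _
  have hcard' : (Finset.univ.filter (fun g => g ∉ Subgroup.zpowers x)).card =
      Fintype.card G - orderOf x := by
    rw [← hcard, Finset.filter_not, Finset.card_sdiff_of_subset (Finset.filter_subset _ _),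
      Finset.card_univ]
  have h3 : ∑ g with g ∉ Subgroup.zpowers x, orderOf g ^ k ≤
      (Fintype.card G - orderOf x) * orderOf x ^ k := by
    rw [← hcard', ← smul_eq_mul]
    exact Finset.sum_le_card_nsmul _ _ _ fun g _ => Nat.pow_le_pow_left (h g) k
  unfold psi
  lia

/-! ### Element orders in the cosets of a normal cyclic Sylow subgroup. -/

/-- If `u ≡ 1` modulo `p` and `u ^ r ≡ 1` modulo `p ^ a` with `p ∤ r`, then `u ≡ 1` modulo
`p ^ a`. -/
theorem int_dvd_sub_one_of_pow {p a r : ℕ} (hp : p.Prime) (hr : ¬ p ∣ r) {u : ℤ}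
    (hu : (p : ℤ) ∣ u - 1) (h : (p : ℤ) ^ a ∣ u ^ r - 1) : (p : ℤ) ^ a ∣ u - 1 := by
  have hg : (∑ i ∈ Finset.range r, u ^ i) * (u - 1) = u ^ r - 1 := geom_sum_mul u r
  have hmod : (∑ i ∈ Finset.range r, u ^ i) ≡ r [ZMOD p] := by
    have h1 : u ≡ 1 [ZMOD p] := (Int.modEq_iff_dvd.2 hu).symm
    calc (∑ i ∈ Finset.range r, u ^ i) ≡ ∑ i ∈ Finset.range r, 1 [ZMOD p] :=
          Int.ModEq.sum fun i _ => by simpa using h1.pow i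
      _ = r := by simp
  have hcop : IsCoprime ((p : ℤ) ^ a) (∑ i ∈ Finset.range r, u ^ i) := by
    refine IsCoprime.pow_left ?_
    rw [(Nat.prime_iff_prime_int.1 hp).irreducible.coprime_iff_not_dvd]
    intro hd
    exact hr (Int.natCast_dvd_natCast.1 ((Int.ModEq.dvd_iff hmod).1 hd))
  rw [← hg] at h
  exact hcop.dvd_of_dvd_mul_left h

/-- If `g` fixes a nontrivial element of a normalized cyclic `p`-subgroup and acts with order prime
to `p`, then it centralizes this subgroup. -/
theorem commute_of_conj_pow_fixed {G : Type*} [Group G] {p a r : ℕ} (hp : p.Prime) (hr : ¬ p ∣ r)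
    {z g v : G} (hz : orderOf z = p ^ a) (hgz : g * z * g⁻¹ ∈ Subgroup.zpowers z)
    (hgr : Commute (g ^ r) z) (hv : v ∈ Subgroup.zpowers z) (hv1 : v ≠ 1) (hgv : Commute g v) :
    Commute g z := by
  obtain ⟨u, hu⟩ := Subgroup.mem_zpowers_iff.1 hgz
  obtain ⟨j, rfl⟩ := Subgroup.mem_zpowers_iff.1 hv
  -- Conjugation by g acts on the cyclic group as the u-th power map. That g ^ r centralizes z gives
  -- u^r ≡ 1, and the fixed v = z^j ≠ 1 gives p^a ∣ (u-1)j with p^a ∤ j, hence p ∣ u-1.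
  have hconj : ∀ m : ℤ, g * z ^ m * g⁻¹ = z ^ (u * m) := fun m => by
    rw [← conj_zpow, ← hu, zpow_mul]
  have hiter : ∀ i : ℕ, g ^ i * z * (g ^ i)⁻¹ = z ^ (u ^ i) := by
    intro i
    induction i with
    | zero => simp
    | succ i ih =>
      rw [pow_succ' g, mul_inv_rev, pow_succ' u, ← hconj, ← ih]
      group
  have h1 : (p : ℤ) ^ a ∣ u ^ r - 1 := by
    have h := hiter r
    rw [hgr.eq, mul_inv_cancel_right] at h
    have h' : z ^ (u ^ r - 1) = 1 := by rw [zpow_sub, ← h]; simp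
    have := orderOf_dvd_iff_zpow_eq_one.2 h'
    rw [hz] at this
    exact_mod_cast this
  have h2 : (p : ℤ) ^ a ∣ (u - 1) * j := by
    have h := hconj j
    rw [hgv.eq, mul_inv_cancel_right] at h
    have h' : z ^ ((u - 1) * j) = 1 := by rw [sub_mul, one_mul, zpow_sub, ← h]; simp
    have := orderOf_dvd_iff_zpow_eq_one.2 h'
    rw [hz] at this
    exact_mod_cast this
  have h3 : ¬ (p : ℤ) ^ a ∣ j := by
    intro hd
    apply hv1
    rw [← orderOf_dvd_iff_zpow_eq_one, hz]
    exact_mod_cast hd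
  have h4 : (p : ℤ) ∣ u - 1 := by
    by_contra hnd
    refine h3 (IsCoprime.dvd_of_dvd_mul_left (IsCoprime.pow_left ?_) h2)
    exact (Nat.prime_iff_prime_int.1 hp).irreducible.coprime_iff_not_dvd.2 hnd
  have h5 := int_dvd_sub_one_of_pow hp hr h4 h1
  have h6 : z ^ (u - 1) = 1 := by
    rw [← orderOf_dvd_iff_zpow_eq_one, hz]
    exact_mod_cast h5
  have h7 : g * z * g⁻¹ = z := by
    rw [← hu, ← sub_add_cancel u 1, zpow_add, h6]; simp
  exact mul_inv_eq_iff_eq_mul.1 h7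

section Coset

theorem sum_coset {G : Type*} [Group G] [Fintype G] {P : Subgroup G} [DecidableEq (G ⧸ P)] [Fintype P] (F : G → ℕ) (g : G) :
    ∑ y : G with (QuotientGroup.mk y : G ⧸ P) = g, F y = ∑ u : P, F (g * u) := by
  symm
  refine Finset.sum_bij (fun (u : P) _ => g * (u : G)) ?_ ?_ ?_ fun _ _ => rfl
  · intro u _
    simp
  · intro u _ v _ h
    exact Subtype.ext (mul_left_cancel h)
  · intro y hy
    have hy' : (y : G ⧸ P) = g := (Finset.mem_filter.1 hy).2
    exact ⟨⟨g⁻¹ * y, QuotientGroup.eq.1 hy'.symm⟩, Finset.mem_univ _, by simp⟩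

theorem not_commute_of_mk_eq {G : Type*} [Group G] {P : Subgroup G} {z : G} (hP : P = Subgroup.zpowers z) {g y : G}
    (hy : (y : G ⧸ P) = g) (hg : ¬ Commute g z) : ¬ Commute y z := by
  intro h
  apply hg
  obtain ⟨j, hj⟩ := Subgroup.mem_zpowers_iff.1
    (show y⁻¹ * g ∈ Subgroup.zpowers z from hP ▸ QuotientGroup.eq.1 hy)
  have : g = y * z ^ j := by rw [hj]; simp
  rw [this]
  exact h.mul_left ((Commute.refl z).zpow_left j)

variable {G : Type*} [Group G] {P : Subgroup G} [P.Normal]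

theorem pow_orderOf_mk_mem (g : G) : g ^ orderOf (g : G ⧸ P) ∈ P := by
  rw [← QuotientGroup.eq_one_iff, QuotientGroup.mk_pow, pow_orderOf_eq_one]

theorem not_dvd_orderOf_mk {p : ℕ} [Finite G] (hindex : ¬ p ∣ P.index) (g : G) :
    ¬ p ∣ orderOf (g : G ⧸ P) := fun h =>
  hindex (h.trans (by rw [Subgroup.index_eq_card]; exact orderOf_dvd_natCard _))

variable [Fintype G]

/-- Outside the centralizer of a normal cyclic Sylow subgroup, element orders are those of the
quotient. -/
theorem orderOf_eq_orderOf_mk {p a : ℕ} (hp : p.Prime) (hindex : ¬ p ∣ P.index) {z : G}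
    (hz : orderOf z = p ^ a) (hP : P = Subgroup.zpowers z) {g : G} (hg : ¬ Commute g z) :
    orderOf g = orderOf (g : G ⧸ P) := by
  refine Nat.dvd_antisymm ?_ (orderOf_map_dvd (QuotientGroup.mk' P) g)
  rw [orderOf_dvd_iff_pow_eq_one]
  -- With m the order of the coset, g^m ≠ 1 would be a nontrivial element of P fixed by g. As p ∤ m,
  -- g would then centralize z.
  by_contra hne
  have hmem : g ^ orderOf (g : G ⧸ P) ∈ Subgroup.zpowers z := hP ▸ pow_orderOf_mk_mem g
  refine hg (commute_of_conj_pow_fixed hp (not_dvd_orderOf_mk hindex g) hz ?_ ?_ hmem hne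
    (Commute.self_pow g _))
  · rw [← hP]
    exact Subgroup.Normal.conj_mem inferInstance z (hP ▸ Subgroup.mem_zpowers z) g
  · obtain ⟨j, hj⟩ := Subgroup.mem_zpowers_iff.1 hmem
    rw [← hj]
    exact (Commute.refl z).zpow_left j

/-- A coset centralizing a normal cyclic Sylow subgroup has a representative whose order is that
of the coset. -/
theorem exists_orderOf_mul_eq {p a : ℕ} (hp : p.Prime) (hindex : ¬ p ∣ P.index) {z : G}
    (hz : orderOf z = p ^ a) (hP : P = Subgroup.zpowers z) {g : G} (hg : Commute g z) :
    ∃ v ∈ P, orderOf (g * v) = orderOf (g : G ⧸ P) ∧ Commute (g * v) z := by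
  have hcop : (Nat.card P).Coprime (orderOf (g : G ⧸ P)) := by
    have hcard : Nat.card P = p ^ a := by rw [hP, Nat.card_zpowers, hz]
    rw [hcard]
    refine Nat.Coprime.pow_left a ?_
    rw [hp.coprime_iff_not_dvd]
    exact not_dvd_orderOf_mk hindex g
  -- The m-th power map is bijective on P, m being the order of the coset, so w can be chosen to
  -- cancel g^m.
  obtain ⟨w, hw⟩ := (powCoprime hcop).surjective ⟨_, P.inv_mem (pow_orderOf_mk_mem g)⟩
  have hw' : (w : G) ^ orderOf (g : G ⧸ P) = (g ^ orderOf (g : G ⧸ P))⁻¹ := by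
    simpa using congrArg Subtype.val hw
  have hwz : (w : G) ∈ Subgroup.zpowers z := hP ▸ w.2
  obtain ⟨j, hj⟩ := Subgroup.mem_zpowers_iff.1 hwz
  have hgw : Commute g w := hj ▸ hg.zpow_right j
  refine ⟨w, w.2, Nat.dvd_antisymm ?_ ?_, ?_⟩
  · rw [orderOf_dvd_iff_pow_eq_one, hgw.mul_pow, hw', mul_inv_cancel]
  · have h := orderOf_map_dvd (QuotientGroup.mk' P) (g * w)
    rwa [map_mul, (QuotientGroup.eq_one_iff (w : G)).2 w.2 |> (show QuotientGroup.mk' P (w : G) = 1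
      from ·), mul_one] at h
  · exact hg.mul_left (hj ▸ (Commute.refl z).zpow_left j)

theorem sum_coset_of_commute [DecidableEq (G ⧸ P)] [Fintype P] (k : ℕ) {p a : ℕ} (hp : p.Prime)
    (hindex : ¬ p ∣ P.index) {z : G} (hz : orderOf z = p ^ a) (hP : P = Subgroup.zpowers z)
    {g : G} (hg : Commute g z) :
    ∑ y : G with (QuotientGroup.mk y : G ⧸ P) = g, orderOf y ^ k ≤ orderOf (g : G ⧸ P) ^ k * psi k P := by
  obtain ⟨v, hv, hov, hvz⟩ := exists_orderOf_mul_eq hp hindex hz hP hg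
  have hmk : ((g * v : G) : G ⧸ P) = g := QuotientGroup.mk_mul_of_mem g hv
  rw [← hmk, sum_coset, psi_subgroup, Finset.mul_sum, hmk, ← hov]
  refine Finset.sum_le_sum fun u _ => ?_
  rw [← mul_pow]
  refine Nat.pow_le_pow_left (Nat.le_of_dvd (Nat.mul_pos (orderOf_pos _) (orderOf_pos _)) ?_) k
  refine Commute.orderOf_mul_dvd_mul_orderOf ?_
  obtain ⟨j, hj⟩ := Subgroup.mem_zpowers_iff.1 (show (u : G) ∈ Subgroup.zpowers z from hP ▸ u.2)
  exact hj ▸ hvz.zpow_right j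

theorem sum_coset_of_not_commute [DecidableEq (G ⧸ P)] [Fintype P] (k : ℕ) {p a : ℕ}
    (hp : p.Prime) (hindex : ¬ p ∣ P.index) {z : G} (hz : orderOf z = p ^ a)
    (hP : P = Subgroup.zpowers z) {g : G} (hg : ¬ Commute g z) :
    ∑ y : G with (QuotientGroup.mk y : G ⧸ P) = g, orderOf y ^ k = orderOf (g : G ⧸ P) ^ k * Fintype.card P := by
  rw [sum_coset, Finset.sum_congr rfl (g := fun _ => orderOf (g : G ⧸ P) ^ k)]
  · simp [mul_comm]
  · intro u _
    have hmk : ((g * u : G) : G ⧸ P) = g := QuotientGroup.mk_mul_of_mem g u.2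
    rw [orderOf_eq_orderOf_mk hp hindex hz hP (not_commute_of_mk_eq hP hmk hg), hmk]

theorem card_le_psi (k : ℕ) (H : Type*) [Group H] [Fintype H] : Fintype.card H ≤ psi k H := by
  unfold psi
  rw [← Finset.card_univ, Finset.card_eq_sum_ones]
  exact Finset.sum_le_sum fun g _ => Nat.one_le_pow _ _ (orderOf_pos g)

theorem psi_le_psi_mul_psi_quotient [Fintype P] [Fintype (G ⧸ P)] (k : ℕ) {p a : ℕ} (hp : p.Prime)
    (hindex : ¬ p ∣ P.index) {z : G} (hz : orderOf z = p ^ a) (hP : P = Subgroup.zpowers z) :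
    psi k G ≤ psi k P * psi k (G ⧸ P) := by
  classical
  have h := Finset.sum_fiberwise Finset.univ (fun y : G => (y : G ⧸ P)) (fun y => orderOf y ^ k)
  unfold psi at *
  rw [← h, Finset.mul_sum]
  refine Finset.sum_le_sum fun c _ => ?_
  obtain ⟨g, rfl⟩ := QuotientGroup.mk_surjective c
  rw [mul_comm]
  by_cases hg : Commute g z
  · exact sum_coset_of_commute k hp hindex hz hP hg
  · rw [sum_coset_of_not_commute k hp hindex hz hP hg]
    exact Nat.mul_le_mul_left _ (card_le_psi k P)

/-- Subtraction-free form of ψ(G) ≤ ψ(P)ψ(Z) + |P|(ψ(G/P) - ψ(Z)): cosets in Z cost a factor ψ(P),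
the others only |P|. -/
theorem psi_le_of_quotient [Fintype P] [Fintype (G ⧸ P)] (k : ℕ) {p a : ℕ} (hp : p.Prime)
    (hindex : ¬ p ∣ P.index) {z : G} (hz : orderOf z = p ^ a) (hP : P = Subgroup.zpowers z)
    (Z : Subgroup (G ⧸ P)) [Fintype Z] (hZ : ∀ g : G, (g : G ⧸ P) ∈ Z ↔ Commute g z) :
    psi k G + Fintype.card P * psi k Z ≤
      psi k P * psi k Z + Fintype.card P * psi k (G ⧸ P) := by
  classical
  have h := Finset.sum_fiberwise Finset.univ (fun y : G => (y : G ⧸ P)) (fun y => orderOf y ^ k)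
  have hZsum : psi k Z = ∑ c with c ∈ Z, orderOf c ^ k := by
    rw [psi_subgroup]
    symm
    exact Finset.sum_subtype _ (by simp) _
  have hG : psi k G ≤ psi k P * ∑ c with c ∈ Z, orderOf c ^ k +
      Fintype.card P * ∑ c with c ∉ Z, orderOf c ^ k := by
    conv_lhs => unfold psi
    rw [← h, ← Finset.sum_filter_add_sum_filter_not Finset.univ (fun c => c ∈ Z), Finset.mul_sum,
      Finset.mul_sum]
    refine add_le_add (Finset.sum_le_sum fun c hc => ?_) (Finset.sum_le_sum fun c hc => ?_)
    · obtain ⟨g, rfl⟩ := QuotientGroup.mk_surjective c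
      rw [mul_comm]
      exact sum_coset_of_commute k hp hindex hz hP ((hZ g).1 (Finset.mem_filter.1 hc).2)
    · obtain ⟨g, rfl⟩ := QuotientGroup.mk_surjective c
      rw [mul_comm]
      exact (sum_coset_of_not_commute k hp hindex hz hP
        fun hg => (Finset.mem_filter.1 hc).2 ((hZ g).2 hg)).le
  have hQ : psi k (G ⧸ P) = psi k Z + ∑ c with c ∉ Z, orderOf c ^ k := by
    rw [hZsum, Finset.sum_filter_add_sum_filter_not]
    rfl
  rw [hQ, mul_add]
  rw [← hZsum] at hG
  lia

end Coset

/-! ### Upper bounds from element orders, and noncyclic 2-groups. -/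

theorem psi_mul_pow_le (k : ℕ) {G : Type*} [Group G] [Fintype G] {m : ℕ}
    (h : ∀ g : G, orderOf g * m ≤ Fintype.card G) :
    psi k G * m ^ k ≤ Fintype.card G * Fintype.card G ^ k := by
  unfold psi
  rw [Finset.sum_mul]
  calc ∑ g : G, orderOf g ^ k * m ^ k ≤ ∑ _g : G, Fintype.card G ^ k :=
        Finset.sum_le_sum fun g _ => by rw [← mul_pow]; exact Nat.pow_le_pow_left (h g) k
    _ = _ := by simp

theorem orderOf_ne_card_of_not_isCyclic {G : Type*} [Group G] [Fintype G] (hG : ¬ IsCyclic G)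
    (g : G) : orderOf g ≠ Fintype.card G := fun h =>
  hG (isCyclic_of_orderOf_eq_card g (by rw [h, Nat.card_eq_fintype_card]))

theorem two_le_two_pow {k : ℕ} (hk : 1 ≤ k) : 2 ≤ 2 ^ k := by
  simpa using Nat.pow_le_pow_right (n := 2) (by norm_num) hk

/-- The bound for noncyclic `2`-groups. -/
theorem psi_le_of_card_eq_two_pow {k : ℕ} (hk : 1 ≤ k) {G : Type*} [Group G] [Fintype G]
    (hG : ¬ IsCyclic G) {a : ℕ} (ha : Fintype.card G = 2 ^ a) :
    (1 + 2 ^ k + 2 * (2 ^ k) ^ 2) * psi k G ≤ (1 + 3 * 2 ^ k) * cycPsi k (2 ^ a) := by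
  have hX := two_le_two_pow hk
  obtain _ | _ | c := a
  · exact absurd (isCyclic_of_card_dvd_prime (p := 2) (by rw [Nat.card_eq_fintype_card, ha]; simp))
      hG
  · exact absurd (isCyclic_of_card_dvd_prime (p := 2) (by rw [Nat.card_eq_fintype_card, ha]; simp))
      hG
  have hdvd : ∀ g : G, orderOf g ∣ 2 ^ (c + 1) := fun g => by
    obtain ⟨i, hi, hgi⟩ := (Nat.dvd_prime_pow Nat.prime_two).1 (ha ▸ orderOf_dvd_card (x := g))
    have hne := orderOf_ne_card_of_not_isCyclic hG g
    rw [hgi]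
    refine pow_dvd_pow 2 ?_
    by_contra hlt
    exact hne (by rw [hgi, ha, show i = c + 1 + 1 by lia])
  have hm : (2 : ℕ) ^ c ≠ 0 := by positivity
  have htot : ((2 : ℕ) ^ (c + 1 + 1)).totient = 2 * 2 ^ c := by
    rw [Nat.totient_prime_pow_succ Nat.prime_two]; ring
  have hsucc := cycPsi_prime_pow_succ k (c + 1) Nat.prime_two
  rw [htot] at hsucc
  -- With |G| = 4·2^c, all main terms are multiples of U = (2^c)^(k+1). The cases are: some element
  -- has order |G|/2, or all orders are at most |G|/4.
  generalize hU : 2 ^ c * (2 ^ c) ^ k = U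
  by_cases hx : ∃ x : G, orderOf x = 2 ^ (c + 1)
  · obtain ⟨x, hx⟩ := hx
    have h1 := psi_le_of_orderOf_le_orderOf k x
      fun g => hx ▸ Nat.le_of_dvd (by positivity) (hdvd g)
    have h2 := cycPsi_two_mul_le k hm
    rw [← pow_succ'] at h2
    rw [hx, ha] at h1
    have e1 : (2 ^ (c + 1 + 1) - 2 ^ (c + 1)) * (2 ^ (c + 1)) ^ k = 2 * 2 ^ k * U := by
      rw [show (2 : ℕ) ^ (c + 1 + 1) - 2 ^ (c + 1) = 2 * 2 ^ c by
        have : (2 : ℕ) ^ (c + 1 + 1) = 4 * 2 ^ c := by ring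
        have : (2 : ℕ) ^ (c + 1) = 2 * 2 ^ c := by ring
        lia, pow_succ' 2 c, mul_pow, ← hU]
      ring
    have e2 : (2 ^ c) ^ (k + 1) + 2 ^ c * (2 ^ (c + 1)) ^ k = U + 2 ^ k * U := by
      rw [pow_succ' 2 c, mul_pow, ← hU]; ring
    have e3 : 2 * 2 ^ c * (2 ^ (c + 1 + 1)) ^ k = 2 * (2 ^ k) ^ 2 * U := by
      rw [pow_succ' 2 (c + 1), pow_succ' 2 c, mul_pow, mul_pow, ← hU]; ring
    rw [e1] at h1
    rw [e2] at h2
    rw [e3] at hsucc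
    rw [hsucc]
    generalize cycPsi k (2 ^ (c + 1)) = F at *
    generalize 2 ^ k = X at *
    obtain ⟨Y, rfl⟩ := Nat.exists_eq_add_of_le hX
    have h3 := Nat.mul_le_mul_left (1 + (2 + Y) + 2 * (2 + Y) ^ 2) h1
    -- For X = 2 + Y, the target minus the bound from `h1` equals 2X(X-1)((1+X)U - F), so `h2` is
    -- exactly what is needed.
    have h4 := Nat.mul_le_mul_left (2 * (2 + Y) * (1 + Y)) h2
    nlinarith
  · push Not at hx
    have h1 : ∀ g : G, orderOf g ≤ 2 ^ c := fun g => by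
      obtain ⟨i, hi, hgi⟩ := (Nat.dvd_prime_pow Nat.prime_two).1 (hdvd g)
      rw [hgi]
      refine Nat.pow_le_pow_right (by norm_num) ?_
      by_contra hlt
      exact hx g (by rw [hgi, show i = c + 1 by lia])
    have h2 := psi_le_of_orderOf_le k _ G h1
    have h3 := totient_mul_pow_le_cycPsi k (n := 2 ^ (c + 1 + 1)) (by positivity)
    have e1 : 2 ^ (c + 1 + 1) * (2 ^ c) ^ k = 4 * U := by rw [← hU]; ring
    have e3 : 2 * 2 ^ c * (2 ^ (c + 1 + 1)) ^ k = 2 * (2 ^ k) ^ 2 * U := by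
      rw [pow_succ' 2 (c + 1), pow_succ' 2 c, mul_pow, mul_pow, ← hU]; ring
    rw [ha, e1] at h2
    rw [htot, e3] at h3
    generalize cycPsi k (2 ^ (c + 1 + 1)) = F at *
    generalize 2 ^ k = X at *
    have h4 : (1 + X + 2 * X ^ 2) * 4 ≤ (1 + 3 * X) * (2 * X ^ 2) := by
      obtain ⟨Y, rfl⟩ := Nat.exists_eq_add_of_le hX
      nlinarith
    calc (1 + X + 2 * X ^ 2) * psi k G ≤ (1 + X + 2 * X ^ 2) * (4 * U) := by gcongr
      _ = (1 + X + 2 * X ^ 2) * 4 * U := by ring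
      _ ≤ (1 + 3 * X) * (2 * X ^ 2) * U := by gcongr
      _ = (1 + 3 * X) * (2 * X ^ 2 * U) := by ring
      _ ≤ _ := by gcongr

/-! ### Groups whose cyclic subgroups all have index at least p. -/

theorem two_pow_le_three_pow_pred {k : ℕ} (hk : 3 ≤ k) : 2 ^ k ≤ 3 ^ (k - 1) := by
  induction k, hk using Nat.le_induction with
  | base => norm_num
  | succ k hk ih =>
    obtain ⟨j, rfl⟩ := Nat.exists_eq_add_of_le hk
    rw [show 3 + j + 1 - 1 = (3 + j - 1) + 1 by lia, pow_succ 3, pow_succ 2]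
    lia

/-- If the index of every cyclic subgroup is at least the largest prime divisor of the order, the
bound holds for `k ≥ 2`. -/
theorem psi_le_of_orderOf_mul_le {k : ℕ} (hk : 2 ≤ k) {G : Type*} [Group G] [Fintype G] {p : ℕ}
    (hp3 : 3 ≤ p) (hp : ∀ q ∈ (Fintype.card G).primeFactors, q ≤ p)
    (h : ∀ g : G, orderOf g * p ≤ Fintype.card G) :
    (1 + 2 ^ k + 2 * (2 ^ k) ^ 2) * psi k G ≤ (1 + 3 * 2 ^ k) * cycPsi k (Fintype.card G) := by
  have h1 := psi_mul_pow_le k h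
  have h2 := totient_mul_pow_le_cycPsi k (n := Fintype.card G) Fintype.card_ne_zero
  have h3 := le_mul_totient (by lia) hp
  have h4 : psi k G * p ^ k ≤ p * cycPsi k (Fintype.card G) := by
    calc _ ≤ Fintype.card G * Fintype.card G ^ k := h1
      _ ≤ p * (Fintype.card G).totient * Fintype.card G ^ k := by gcongr
      _ = p * ((Fintype.card G).totient * Fintype.card G ^ k) := by ring
      _ ≤ _ := by gcongr
  have h5 : (1 + 2 ^ k + 2 * (2 ^ k) ^ 2) * p ≤ (1 + 3 * 2 ^ k) * p ^ k := by
    -- 2^k ≤ 3^(k-1) fails at k = 2, where 37p ≤ 13p² holds directly for p ≥ 3.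
    obtain rfl | hk3 := hk.eq_or_lt
    · nlinarith
    have hpk : 2 ^ k ≤ p ^ (k - 1) :=
      (two_pow_le_three_pow_pred hk3).trans (Nat.pow_le_pow_left hp3 _)
    have hX := two_le_two_pow (show 1 ≤ k by lia)
    calc (1 + 2 ^ k + 2 * (2 ^ k) ^ 2) * p ≤ ((1 + 3 * 2 ^ k) * 2 ^ k) * p := by
          gcongr
          nlinarith
      _ ≤ ((1 + 3 * 2 ^ k) * p ^ (k - 1)) * p := by gcongr
      _ = (1 + 3 * 2 ^ k) * p ^ k := by rw [mul_assoc, ← pow_succ]; congr 2; lia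
  have hpp : 0 < p ^ k := by positivity
  refine le_of_mul_le_mul_right ?_ hpp
  calc (1 + 2 ^ k + 2 * (2 ^ k) ^ 2) * psi k G * p ^ k
      = (1 + 2 ^ k + 2 * (2 ^ k) ^ 2) * (psi k G * p ^ k) := by ring
    _ ≤ (1 + 2 ^ k + 2 * (2 ^ k) ^ 2) * (p * cycPsi k (Fintype.card G)) := by gcongr
    _ = (1 + 2 ^ k + 2 * (2 ^ k) ^ 2) * p * cycPsi k (Fintype.card G) := by ring
    _ ≤ (1 + 3 * 2 ^ k) * p ^ k * cycPsi k (Fintype.card G) := by gcongr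
    _ = _ := by ring

/-- The general estimates give only 11/3 against 7/2, just too weak. Odd n is a power of 3, with
ψ_1(ℤ_n) > 3n²/4. For even n = 6m with an element of order 2m, ψ_1(G) ≤ 11m². In the remaining case
orders are at most n/4. -/
theorem psi_one_le_of_orderOf_mul_three_le {G : Type*} [Group G] [Fintype G]
    (hp : ∀ q ∈ (Fintype.card G).primeFactors, q ≤ 3)
    (h : ∀ g : G, orderOf g * 3 ≤ Fintype.card G) :
    11 * psi 1 G ≤ 7 * cycPsi 1 (Fintype.card G) := by
  have h1 := psi_mul_pow_le 1 h
  have h2 := two_mul_sq_le_cycPsi_one Fintype.card_ne_zero (by norm_num) hp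
  simp only [pow_one] at h1
  by_cases hodd : Odd (Fintype.card G)
  · have hpow := Nat.eq_prime_pow_of_unique_prime_dvd (p := 3) (n := Fintype.card G)
      Fintype.card_ne_zero fun {d} hd hdvd => by
        have := hp d (Nat.mem_primeFactors.2 ⟨hd, hdvd, Fintype.card_ne_zero⟩)
        have := hd.two_le
        have : d ≠ 2 := by
          rintro rfl
          exact Nat.not_even_iff_odd.2 hodd (even_iff_two_dvd.2 hdvd)
        lia
    have h3 := cycPsi_one_prime_pow Nat.prime_three (Fintype.card G).primeFactorsList.length
    rw [← hpow] at h3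
    nlinarith
  · by_cases hx : ∃ x : G, orderOf x * 3 = Fintype.card G
    · obtain ⟨x, hx⟩ := hx
      have h3 := psi_le_of_orderOf_le_orderOf 1 x fun g => by have := h g; lia
      obtain ⟨m, hm⟩ : Even (orderOf x) := by
        rw [← hx] at hodd
        by_contra hne
        exact hodd ((Nat.not_even_iff_odd.1 hne).mul (by decide))
      have hm0 : m ≠ 0 := by
        rintro rfl
        exact (orderOf_pos x).ne' hm
      have h4 := cycPsi_two_mul_le 1 hm0
      rw [← two_mul] at hm
      rw [← hx, hm, show 2 * m * 3 - 2 * m = 4 * m by lia] at h3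
      rw [← hx, hm] at h2 ⊢
      simp only [pow_one, Nat.reduceAdd] at *
      nlinarith
    · push Not at hx
      have h3 := psi_mul_pow_le (m := 4) 1 fun g : G => by
        obtain ⟨m, hm⟩ := orderOf_dvd_card (x := g)
        have hg := h g
        have hne := hx g
        have hpos := orderOf_pos g
        rw [hm] at hg hne ⊢
        have h5 := Nat.le_of_mul_le_mul_left hg hpos
        have h6 : m ≠ 3 := fun h => hne (by rw [h])
        exact Nat.mul_le_mul_left _ (by lia)
      nlinarith

theorem psi_one_le_of_orderOf_mul_le {G : Type*} [Group G] [Fintype G] {p : ℕ}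
    (hp5 : 5 ≤ p) (hp : ∀ q ∈ (Fintype.card G).primeFactors, q ≤ p)
    (h : ∀ g : G, orderOf g * p ≤ Fintype.card G) :
    11 * psi 1 G ≤ 7 * cycPsi 1 (Fintype.card G) := by
  have h1 := psi_mul_pow_le 1 h
  have h2 := two_mul_sq_le_cycPsi_one Fintype.card_ne_zero (by lia) hp
  simp only [pow_one] at h1
  have hpp : 0 < p * (p + 1) := by positivity
  refine le_of_mul_le_mul_right ?_ hpp
  calc 11 * psi 1 G * (p * (p + 1)) = 11 * (p + 1) * (psi 1 G * p) := by ring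
    _ ≤ 11 * (p + 1) * (Fintype.card G * Fintype.card G) := by gcongr
    _ ≤ 14 * p * (Fintype.card G * Fintype.card G) := by
        gcongr ?_ * _
        -- 11(p+1) ≤ 14p is where p ≥ 5 enters; it fails for p = 3.
        lia
    _ = 7 * p * (2 * Fintype.card G ^ 2) := by ring
    _ ≤ 7 * p * ((p + 1) * cycPsi 1 (Fintype.card G)) := by gcongr
    _ = _ := by ring

theorem psi_le_of_forall_orderOf_mul_le {k : ℕ} (hk : 1 ≤ k) {G : Type*} [Group G] [Fintype G]
    {p : ℕ} (hpp : p.Prime) (hp2 : p ≠ 2) (hp : ∀ q ∈ (Fintype.card G).primeFactors, q ≤ p)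
    (h : ∀ g : G, orderOf g * p ≤ Fintype.card G) :
    (1 + 2 ^ k + 2 * (2 ^ k) ^ 2) * psi k G ≤ (1 + 3 * 2 ^ k) * cycPsi k (Fintype.card G) := by
  have hp3 : 3 ≤ p := by have := hpp.two_le; lia
  obtain rfl | hk2 := hk.eq_or_lt
  · norm_num
    obtain rfl | hp4 := hp3.eq_or_lt
    · exact psi_one_le_of_orderOf_mul_three_le hp h
    · refine psi_one_le_of_orderOf_mul_le ?_ hp h
      have : p ≠ 4 := by rintro rfl; norm_num at hpp
      lia
  · exact psi_le_of_orderOf_mul_le hk2 hp3 hp h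

/-! ### A normal cyclic Sylow subgroup with cyclic quotient. -/

theorem one_add_mul_three_pow_le_psi (k : ℕ) {H : Type*} [Group H] [Fintype H]
    (hH : Odd (Fintype.card H)) : 1 + (Fintype.card H - 1) * 3 ^ k ≤ psi k H := by
  classical
  unfold psi
  rw [← Finset.add_sum_erase _ _ (Finset.mem_univ (1 : H)), orderOf_one, one_pow]
  refine Nat.add_le_add_left ?_ 1
  rw [← Finset.card_univ, ← Finset.card_erase_of_mem (Finset.mem_univ (1 : H)), ← smul_eq_mul]
  refine Finset.card_nsmul_le_sum _ _ _ fun g hg => Nat.pow_le_pow_left ?_ k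
  have h1 : orderOf g ≠ 1 := fun h => Finset.ne_of_mem_erase hg (orderOf_eq_one_iff.1 h)
  have h2 : orderOf g ≠ 2 := fun h => by
    have hd := orderOf_dvd_card (x := g)
    rw [h] at hd
    exact Nat.not_even_iff_odd.2 hH (even_iff_two_dvd.2 hd)
  have h3 := orderOf_pos g
  lia

theorem two_pow_three_pow_ineq {k : ℕ} (hk : 1 ≤ k) :
    (1 + 2 ^ k + 2 * (2 ^ k) ^ 2) * (1 + 2 * 3 ^ k + 3 * 2 ^ k) ≤
      (1 + 3 * 2 ^ k) * (1 + 2 ^ k) * (1 + 2 * 3 ^ k) := by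
  -- The right side minus the left side of the goal is 2·2^k times the gap in this inequality.
  have hkey : 2 ^ k + 3 * (2 ^ k) ^ 2 ≤ 3 ^ k * (3 + 2 ^ k) := by
    obtain rfl | rfl | hk3 : k = 1 ∨ k = 2 ∨ 3 ≤ k := by lia
    · norm_num
    · norm_num
    · have h := two_pow_le_three_pow_pred hk3
      have h3 : 3 ^ k = 3 * 3 ^ (k - 1) := by rw [← pow_succ']; congr 1; lia
      rw [h3]
      generalize 2 ^ k = X at *
      generalize 3 ^ (k - 1) = W at *
      nlinarith [Nat.mul_le_mul_right X h]
  have h := Nat.mul_le_mul_left (2 * 2 ^ k) hkey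
  ring_nf at h ⊢
  lia

/-- A cyclic subgroup whose index is less than the prime `p` contains a Sylow `p`-subgroup, which is
then normal. -/
theorem exists_normal_zpowers {G : Type*} [Group G] [Fintype G] {p : ℕ} (hp : p.Prime) {x : G}
    (hx : Fintype.card G < orderOf x * p) :
    ∃ z : G, orderOf z = p ^ (Fintype.card G).factorization p ∧ (Subgroup.zpowers z).Normal := by
  have : Fact p.Prime := ⟨hp⟩
  have hidx : (Subgroup.zpowers x).index < p := by
    have h := (Subgroup.zpowers x).card_mul_index
    rw [Nat.card_zpowers, Nat.card_eq_fintype_card] at h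
    rw [← h] at hx
    exact Nat.lt_of_mul_lt_mul_left hx
  have hidx0 : (Subgroup.zpowers x).index ≠ 0 := Subgroup.index_ne_zero_of_finite
  have hmul := (Subgroup.zpowers x).card_mul_index
  rw [Nat.card_zpowers, Nat.card_eq_fintype_card] at hmul
  have hdvd : p ^ (Fintype.card G).factorization p ∣ orderOf x := by
    refine Nat.Coprime.dvd_of_dvd_mul_right (n := (Subgroup.zpowers x).index) ?_ ?_
    · exact Nat.Coprime.pow_left _ ((Nat.Prime.coprime_iff_not_dvd hp).2
        fun h => (Nat.le_of_dvd (Nat.pos_of_ne_zero hidx0) h).not_gt hidx)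
    · rw [hmul]
      exact Nat.ordProj_dvd _ _
  obtain ⟨d, hd⟩ := hdvd
  have hd0 : d ≠ 0 := by
    rintro rfl
    exact (orderOf_pos x).ne' hd
  have hz : orderOf (x ^ d) = p ^ (Fintype.card G).factorization p := by
    rw [orderOf_pow_of_dvd hd0 ⟨_, hd.trans (mul_comm _ _)⟩, hd,
      Nat.mul_div_cancel _ (Nat.pos_of_ne_zero hd0)]
  refine ⟨x ^ d, hz, ?_⟩
  let S : Sylow p G := Sylow.ofCard (Subgroup.zpowers (x ^ d)) (by
    rw [Nat.card_zpowers, hz, Nat.card_eq_fintype_card])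
  have hS : (S : Subgroup G) = Subgroup.zpowers (x ^ d) := rfl
  have hle : Subgroup.zpowers x ≤ Subgroup.normalizer (S : Set G) := by
    rw [Subgroup.zpowers_le]
    refine Subgroup.mem_normalizer_iff.2 fun y => ?_
    have hc : ∀ w ∈ Subgroup.zpowers (x ^ d), Commute x w := by
      intro w hw
      obtain ⟨j, rfl⟩ := Subgroup.mem_zpowers_iff.1 hw
      exact (Commute.self_pow x d).zpow_right j
    constructor
    · intro hy
      have : x * y * x⁻¹ = y := by rw [(hc y hy).eq]; simp
      rwa [this]
    · intro hy
      have h := (hc _ hy).eq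
      have : x * y * x⁻¹ = y := by
        have h' : x * y = x * y * x⁻¹ * x := by group
        have h'' : x * (x * y * x⁻¹) = x * y := by rw [h, ← h']
        exact mul_left_cancel h''
      rwa [this] at hy
  have hcard : Nat.card (Sylow p G) < p := by
    rw [S.card_eq_index_normalizer]
    exact (Nat.le_of_dvd (Nat.pos_of_ne_zero hidx0) (Subgroup.index_dvd_of_le hle)).trans_lt hidx
  -- The number of Sylow p-subgroups is below p and congruent to 1 modulo p.
  have hone : Nat.card (Sylow p G) = 1 := by
    have h := card_sylow_modEq_one p G
    rwa [Nat.ModEq, Nat.mod_eq_of_lt hcard, Nat.mod_eq_of_lt hp.one_lt] at h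
  have : Subsingleton (Sylow p G) := (Nat.card_eq_one_iff_unique.1 hone).1
  exact hS ▸ S.normal_of_subsingleton

/-- The bound for a noncyclic group with a cyclic normal Sylow subgroup of odd order and cyclic
quotient. -/
theorem psi_le_of_isCyclic_quotient {k : ℕ} (hk : 1 ≤ k) {G : Type*} [Group G] [Fintype G]
    (hG : ¬ IsCyclic G) {P : Subgroup G} [P.Normal] [Fintype P] [Fintype (G ⧸ P)]
    (hcyc : IsCyclic (G ⧸ P)) {p a : ℕ} (hp : p.Prime) (hp2 : p ≠ 2) (ha : a ≠ 0)
    (hindex : ¬ p ∣ P.index) {z : G} (hz : orderOf z = p ^ a) (hP : P = Subgroup.zpowers z) :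
    (1 + 2 ^ k + 2 * (2 ^ k) ^ 2) * psi k G ≤
      (1 + 3 * 2 ^ k) * (psi k P * psi k (G ⧸ P)) := by
  classical
  have hmemP : ∀ g : G, g ∈ P → Commute g z := by
    intro g hg
    obtain ⟨j, rfl⟩ := Subgroup.mem_zpowers_iff.1 (hP ▸ hg)
    exact (Commute.refl z).zpow_left j
  let Z : Subgroup (G ⧸ P) := (Subgroup.centralizer {z}).map (QuotientGroup.mk' P)
  have hZ : ∀ g : G, (g : G ⧸ P) ∈ Z ↔ Commute g z := by
    intro g
    constructor
    · rintro ⟨y, hy, hyg⟩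
      have hyz : Commute y z := (Subgroup.mem_centralizer_singleton_iff.1 hy)
      have hyg' : (y : G ⧸ P) = g := hyg
      have h := hyz.mul_left (hmemP _ (QuotientGroup.eq.1 hyg'))
      rwa [mul_inv_cancel_left] at h
    · intro h
      exact ⟨g, Subgroup.mem_centralizer_singleton_iff.2 h, rfl⟩
  have hcardP : Fintype.card P = p ^ a := by
    rw [← Nat.card_eq_fintype_card, hP, Nat.card_zpowers, hz]
  have hmul : Fintype.card P * Fintype.card (G ⧸ P) = Fintype.card G := by
    simp only [← Nat.card_eq_fintype_card]
    rw [← P.index_eq_card, P.card_mul_index]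
  -- Otherwise a generator of G/P lifts to an element of the same order commuting with z; its
  -- product with z has order |G|, making G cyclic.
  have hZtop : Z ≠ ⊤ := by
    intro htop
    obtain ⟨c, hc⟩ := hcyc.exists_ofOrder_eq_natCard
    obtain ⟨g, rfl⟩ := QuotientGroup.mk_surjective c
    have hgz : Commute g z := (hZ g).1 (htop ▸ Subgroup.mem_top _)
    obtain ⟨v, -, hv, hvz⟩ := exists_orderOf_mul_eq hp hindex hz hP hgz
    refine orderOf_ne_card_of_not_isCyclic hG (g * v * z) ?_
    rw [hvz.orderOf_mul_eq_mul_orderOf_of_coprime, hv, hz, hc, ← hmul, hcardP,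
      Nat.card_eq_fintype_card, mul_comm]
    rw [hv, hz]
    exact (Nat.Coprime.pow_left a ((Nat.Prime.coprime_iff_not_dvd hp).2
      (not_dvd_orderOf_mk hindex g))).symm
  have hcardZ : Fintype.card Z ≠ Fintype.card (G ⧸ P) := by
    intro h
    apply hZtop
    apply Subgroup.eq_top_of_card_eq
    simpa only [Nat.card_eq_fintype_card] using h
  have hS : (1 + 2 ^ k) * psi k Z ≤ psi k (G ⧸ P) := by
    rw [psi_eq_cycPsi, psi_eq_cycPsi]
    refine one_add_two_pow_mul_cycPsi_le k ?_ hcardZ Fintype.card_ne_zero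
    simpa only [Nat.card_eq_fintype_card] using Z.card_subgroup_dvd_card
  have hquot := psi_le_of_quotient k hp hindex hz hP Z hZ
  have hodd : Odd (Fintype.card P) := by
    rw [hcardP]
    exact (hp.odd_of_ne_two hp2).pow
  have hN3 : 3 ≤ Fintype.card P := by
    rw [hcardP]
    have : 3 ≤ p := by have := hp.two_le; lia
    exact this.trans (Nat.le_self_pow ha p)
  -- The average of o(u)^k over P is at least (1 + 2·3^k)/3, its value for |P| = 3.
  have hpsiP : Fintype.card P * (1 + 2 * 3 ^ k) ≤ 3 * psi k P := by
    have h := one_add_mul_three_pow_le_psi k hodd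
    obtain ⟨N, hN⟩ := Nat.exists_eq_add_of_le hN3
    rw [hN, show 3 + N - 1 = N + 2 by lia] at h
    rw [hN]
    have h3 : 1 ≤ 3 ^ k := Nat.one_le_pow _ _ (by norm_num)
    nlinarith [Nat.mul_le_mul_left N h3]
  have hcP := card_le_psi k P
  have hnum := two_pow_three_pow_ineq hk
  generalize psi k G = A at *
  generalize psi k P = Ψ at *
  generalize psi k (G ⧸ P) = F at *
  generalize psi k Z = S at *
  generalize Fintype.card P = N at *
  generalize 2 ^ k = X at *
  generalize 3 ^ k = Y at *
  -- D = ψ(P) - |P| is the excess paid on cosets in Z. Using S ≤ F/(1+X) and N/(N+D) ≤ 3/(1+2Y)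
  -- leaves the numerical inequality `hnum`.
  obtain ⟨D, rfl⟩ := Nat.exists_eq_add_of_le hcP
  have h1 : A ≤ D * S + N * F := by nlinarith
  have h2 : (1 + X) * A ≤ F * (N + D + X * N) := by
    calc (1 + X) * A ≤ (1 + X) * (D * S + N * F) := by gcongr
      _ = D * ((1 + X) * S) + (1 + X) * N * F := by ring
      _ ≤ D * F + (1 + X) * N * F := by gcongr
      _ = _ := by ring
  have h3 : (1 + 2 * Y) * (1 + X) * A ≤ F * (N + D) * (1 + 2 * Y + 3 * X) := by
    calc (1 + 2 * Y) * (1 + X) * A = (1 + 2 * Y) * ((1 + X) * A) := by ring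
      _ ≤ (1 + 2 * Y) * (F * (N + D + X * N)) := by gcongr
      _ = F * ((N + D) * (1 + 2 * Y) + X * (N * (1 + 2 * Y))) := by ring
      _ ≤ F * ((N + D) * (1 + 2 * Y) + X * (3 * (N + D))) := by gcongr
      _ = _ := by ring
  have hpos : 0 < (1 + 2 * Y) * (1 + X) := by positivity
  refine le_of_mul_le_mul_left ?_ hpos
  calc (1 + 2 * Y) * (1 + X) * ((1 + X + 2 * X ^ 2) * A)
      = (1 + X + 2 * X ^ 2) * ((1 + 2 * Y) * (1 + X) * A) := by ring
    _ ≤ (1 + X + 2 * X ^ 2) * (F * (N + D) * (1 + 2 * Y + 3 * X)) := by gcongr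
    _ = F * (N + D) * ((1 + X + 2 * X ^ 2) * (1 + 2 * Y + 3 * X)) := by ring
    _ ≤ F * (N + D) * ((1 + 3 * X) * (1 + X) * (1 + 2 * Y)) := by gcongr
    _ = _ := by ring

/-! ### The induction on the group order. -/

theorem psi_le_cycPsi_of_not_isCyclic {k : ℕ} (hk : 1 ≤ k) (n : ℕ) :
    ∀ (G : Type*) [Group G] [Fintype G], Fintype.card G = n → ¬ IsCyclic G →
      (1 + 2 ^ k + 2 * (2 ^ k) ^ 2) * psi k G ≤ (1 + 3 * 2 ^ k) * cycPsi k n := by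
  induction n using Nat.strong_induction_on with
  | _ n ih =>
  intro G _ _ hcard hG
  classical
  have hn0 : n ≠ 0 := hcard ▸ Fintype.card_ne_zero
  have hn1 : n ≠ 1 := by
    rintro rfl
    have : Subsingleton G := Fintype.card_le_one_iff_subsingleton.1 hcard.le
    exact hG inferInstance
  have hne : n.primeFactors.Nonempty := Nat.nonempty_primeFactors.2 (by lia)
  obtain ⟨p, hpmem, hpmax⟩ := n.primeFactors.exists_max_image id hne
  simp only [id] at hpmax
  have hp := Nat.prime_of_mem_primeFactors hpmem
  have hpn := Nat.dvd_of_mem_primeFactors hpmem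
  by_cases hp2 : p = 2
  · have hpow := Nat.eq_prime_pow_of_unique_prime_dvd (p := 2) hn0 fun {d} hd hdvd => by
      have := hpmax d (Nat.mem_primeFactors.2 ⟨hd, hdvd, hn0⟩)
      have := hd.two_le
      lia
    rw [hpow]
    exact psi_le_of_card_eq_two_pow hk hG (hcard.trans hpow)
  subst hcard
  -- If this fails, some cyclic subgroup has index less than p.
  by_cases hx : ∀ g : G, orderOf g * p ≤ Fintype.card G
  · exact psi_le_of_forall_orderOf_mul_le hk hp hp2 hpmax hx
  push Not at hx
  obtain ⟨x, hx⟩ := hx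
  obtain ⟨z, hz, hnorm⟩ := exists_normal_zpowers hp hx
  have ha : (Fintype.card G).factorization p ≠ 0 := (hp.factorization_pos_of_dvd hn0 hpn).ne'
  generalize hP : Subgroup.zpowers z = P at *
  have hcardP : Nat.card P = p ^ (Fintype.card G).factorization p := by
    rw [← hP, Nat.card_zpowers, hz]
  have hmul : p ^ (Fintype.card G).factorization p * P.index = Fintype.card G := by
    rw [← hcardP, P.card_mul_index, Nat.card_eq_fintype_card]
  have hindex : ¬ p ∣ P.index := by
    intro hd
    have h := mul_dvd_mul_left (p ^ (Fintype.card G).factorization p) hd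
    rw [hmul, ← pow_succ] at h
    exact Nat.pow_succ_factorization_not_dvd hn0 hp h
  have hcop : (p ^ (Fintype.card G).factorization p).Coprime P.index :=
    Nat.Coprime.pow_left _ ((Nat.Prime.coprime_iff_not_dvd hp).2 hindex)
  have hcardQ : Fintype.card (G ⧸ P) = P.index := by
    rw [P.index_eq_card, Nat.card_eq_fintype_card]
  have : IsCyclic P := hP ▸ inferInstance
  have hpsiP : psi k P = cycPsi k (p ^ (Fintype.card G).factorization p) := by
    rw [psi_eq_cycPsi, ← Nat.card_eq_fintype_card, hcardP]
  have hcyc : cycPsi k (Fintype.card G) = psi k P * cycPsi k P.index := by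
    conv_lhs => rw [← hmul]
    rw [cycPsi_mul_of_coprime k hcop, hpsiP]
  rw [hcyc]
  by_cases hQ : IsCyclic (G ⧸ P)
  · have h := psi_le_of_isCyclic_quotient hk hG hQ hp hp2 ha hindex hz hP.symm
    rwa [psi_eq_cycPsi k (G ⧸ P), hcardQ] at h
  · have hlt : P.index < Fintype.card G := by
      rw [← hmul]
      have h1 : 1 < p ^ (Fintype.card G).factorization p := Nat.one_lt_pow ha hp.one_lt
      have h2 : 0 < P.index := Nat.pos_of_ne_zero Subgroup.index_ne_zero_of_finite
      nlinarith
    have h := ih _ hlt (G ⧸ P) hcardQ hQ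
    calc (1 + 2 ^ k + 2 * (2 ^ k) ^ 2) * psi k G
        ≤ (1 + 2 ^ k + 2 * (2 ^ k) ^ 2) * (psi k P * psi k (G ⧸ P)) := by
          gcongr
          exact psi_le_psi_mul_psi_quotient k hp hindex hz hP.symm
      _ = psi k P * ((1 + 2 ^ k + 2 * (2 ^ k) ^ 2) * psi k (G ⧸ P)) := by ring
      _ ≤ psi k P * ((1 + 3 * 2 ^ k) * cycPsi k P.index) := by gcongr
      _ = _ := by ring

/-! ### The groups attaining equality, and the final statement. -/

theorem psi_cyc (k n : ℕ) [NeZero n] : psi k (Cyc n) = cycPsi k n := by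
  rw [psi_eq_cycPsi, Fintype.card_multiplicative, ZMod.card]

theorem psi_prod_of_coprime (k : ℕ) (A B : Type*) [Group A] [Group B] [Fintype A] [Fintype B]
    (h : (Fintype.card A).Coprime (Fintype.card B)) :
    psi k (A × B) = psi k A * psi k B := by
  unfold psi
  rw [Finset.sum_mul_sum, Fintype.sum_prod_type]
  refine Finset.sum_congr rfl fun a _ => Finset.sum_congr rfl fun b _ => ?_
  have hab : (orderOf a).Coprime (orderOf b) :=
    Nat.Coprime.of_dvd orderOf_dvd_card orderOf_dvd_card h
  rw [Prod.orderOf_mk, hab.lcm_eq_mul, mul_pow]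

theorem cyc_two_prod_sq (g : Cyc 2 × Cyc 2) : g ^ 2 = 1 := by
  revert g
  decide

theorem psi_cyc_two_prod (k : ℕ) : psi k (Cyc 2 × Cyc 2) = 1 + 3 * 2 ^ k := by
  unfold psi
  rw [← Finset.add_sum_erase _ _ (Finset.mem_univ (1 : Cyc 2 × Cyc 2)), orderOf_one, one_pow,
    Finset.sum_congr rfl (g := fun _ => 2 ^ k)]
  · rw [Finset.sum_const, smul_eq_mul, Finset.card_erase_of_mem (Finset.mem_univ _),
      Finset.card_univ]
    rfl
  · intro g hg
    rw [orderOf_eq_prime (cyc_two_prod_sq g) (Finset.ne_of_mem_erase hg)]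

theorem cycPsi_four (k : ℕ) : cycPsi k 4 = 1 + 2 ^ k + 2 * 4 ^ k := by
  have h1 := cycPsi_prime_pow_succ k 0 Nat.prime_two
  have h2 := cycPsi_prime_pow_succ k 1 Nat.prime_two
  rw [Nat.totient_prime_pow_succ Nat.prime_two] at h1 h2
  norm_num at h1 h2
  rw [h2, h1]

theorem card_cyc_prod (t : ℕ) [NeZero t] :
    Fintype.card (Cyc t × Cyc 2 × Cyc 2) = 4 * t := by
  rw [Fintype.card_prod, Fintype.card_prod, Fintype.card_multiplicative,
    Fintype.card_multiplicative, ZMod.card, ZMod.card]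
  ring

theorem not_isCyclic_cyc_prod (t : ℕ) [NeZero t] : ¬ IsCyclic (Cyc t × Cyc 2 × Cyc 2) := by
  intro h
  obtain ⟨g, hg⟩ := h.exists_ofOrder_eq_natCard
  rw [Nat.card_eq_fintype_card, card_cyc_prod] at hg
  -- The exponent divides 2t, so no element has order 4t.
  have hpow : g ^ (2 * t) = 1 := by
    refine Prod.ext ?_ ?_
    · have h1 := pow_card_eq_one (x := g.1)
      rw [Fintype.card_multiplicative, ZMod.card] at h1
      rw [Prod.pow_fst, mul_comm, pow_mul, h1, one_pow, Prod.fst_one]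
    · rw [Prod.pow_snd, pow_mul, cyc_two_prod_sq, one_pow, Prod.snd_one]
  have ht := NeZero.pos t
  have hle := Nat.le_of_dvd (by positivity) (orderOf_dvd_of_pow_eq_one hpow)
  lia

theorem psi_le_psi_cyc (G : Type*) [Group G] [Fintype G] (n : ℕ) [NeZero n] (k : ℕ)
    (hcard : Fintype.card G = n) (hG : ¬ IsCyclic G) (hk : 1 ≤ k) :
    (psi k G : ℝ) ≤ (1 + 3 * 2 ^ k) / (1 + 2 ^ k + 2 * 4 ^ k) * (psi k (Cyc n) : ℝ) := by
  have h := psi_le_cycPsi_of_not_isCyclic hk n G hcard hG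
  rw [← psi_cyc, show ((2 : ℕ) ^ k) ^ 2 = 4 ^ k by rw [← pow_mul, mul_comm, pow_mul]; norm_num] at h
  rw [div_mul_eq_mul_div, le_div_iff₀ (by positivity), mul_comm]
  exact_mod_cast h

theorem theorem4 :
    -- the bound for every non-cyclic finite group and every positive integer `k`
    (∀ (G : Type*) [Group G] [Fintype G] (n : ℕ) [NeZero n] (k : ℕ),
      Fintype.card G = n → ¬ IsCyclic G → 1 ≤ k →
        (psi k G : ℝ) ≤ (1 + 3 * 2 ^ k) / (1 + 2 ^ k + 2 * 4 ^ k) * (psi k (Cyc n) : ℝ)) ∧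
    -- the case `k = 1`
    (∀ (G : Type*) [Group G] [Fintype G] (n : ℕ) [NeZero n],
      Fintype.card G = n → ¬ IsCyclic G →
        (psi 1 G : ℝ) ≤ 7 / 11 * (psi 1 (Cyc n) : ℝ)) ∧
    -- the bound is attained by `ℤ_t × ℤ_2 × ℤ_2` for every odd positive `t`
    (∀ (t : ℕ) [NeZero t] (k : ℕ), Odd t → 1 ≤ k →
      Fintype.card (Cyc t × Cyc 2 × Cyc 2) = 4 * t ∧
      ¬ IsCyclic (Cyc t × Cyc 2 × Cyc 2) ∧
      (psi k (Cyc t × Cyc 2 × Cyc 2) : ℝ) =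
        (1 + 3 * 2 ^ k) / (1 + 2 ^ k + 2 * 4 ^ k) * (psi k (Cyc (4 * t)) : ℝ)) := by
  refine ⟨fun G _ _ n _ k hcard hG hk => psi_le_psi_cyc G n k hcard hG hk,
    fun G _ _ n _ hcard hG => ?_, fun t _ k ht _ => ⟨card_cyc_prod t, not_isCyclic_cyc_prod t, ?_⟩⟩
  · have h := psi_le_psi_cyc G n 1 hcard hG le_rfl
    norm_num at h ⊢
    exact h
  · have hcop : (4 : ℕ).Coprime t := by
      simpa using (Nat.coprime_two_left.2 ht).pow_left 2
    have h1 : psi k (Cyc t × Cyc 2 × Cyc 2) = psi k (Cyc t) * psi k (Cyc 2 × Cyc 2) := by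
      refine psi_prod_of_coprime k _ _ ?_
      rw [Fintype.card_multiplicative, ZMod.card]
      exact hcop.symm
    rw [h1, psi_cyc, psi_cyc, psi_cyc_two_prod, cycPsi_mul_of_coprime k hcop, cycPsi_four]
    push_cast
    field_simp
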